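/- Let $n, m \ge 0$ and let $\mathcal D$ be the finite set of all binary $n \times m$ matrices (datasets). A \emph{tile} $T$ consists of a nonempty set $t(T)$ of rows and a nonempty set $a(T)$ of columns; its frequency in a dataset $D$ is $\mathrm{fr}(T; D) = \frac{1}{|t(T)|\,|a(T)|}\sum_{i \in t(T)}\sum_{j \in a(T)} D(i,j)$, and its frequency under a probability distribution $p$ on $\mathcal D$ is $\mathrm{fr}(T;p) = \sum_{D \in \mathcal D} p(D)\,\mathrm{fr}(T; D)$. A \emph{tile set} $\mathcal S$ is a collection of tiles $T$, each given with a target frequency $\alpha_T \in \mathbb R$. A tile is \emph{exact} if its target frequency is $0$ or $1$. A tile set $\mathcal S$ is \emph{consistent} if some probability distribution $p$ on $\mathcal D$ satisfies $\mathrm{fr}(T;p) = \alpha_T$ for all $T \in \mathcal S$; in this case $p^*_{\mathcal S}$ denotes the unique distribution of maximal entropy $-\sum_{D} p(D)\log p(D)$ among all such $p$. Write $\mathrm{KL}(\mathcal A\,\|\,\mathcal C) = \sum_{D \in \mathcal D} p^*_{\mathcal A}(D) \log\frac{p^*_{\mathcal A}(D)}{p^*_{\mathcal C}(D)}$ for the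 Kullback--Leibler divergence (with $0 \log 0 = 0$). Let $\mathcal T, \mathcal U, \mathcal B$ be tile sets (with arbitrary, possibly noisy, target frequencies) such that $\mathcal M = \mathcal T \cup \mathcal U \cup \mathcal B$ is consistent, and define $$d(\mathcal T, \mathcal U; \mathcal B) = \frac{\mathrm{KL}(\mathcal M\,\|\,\mathcal U \cup \mathcal B) + \mathrm{KL}(\mathcal M\,\|\,\mathcal T \cup \mathcal B)}{\mathrm{KL}(\mathcal M\,\|\,\mathcal B)}$$ if $\mathrm{KL}(\mathcal M\,\|\,\mathcal B) \neq 0$, and $d(\mathcal T, \mathcal U; \mathcal B) = 1$ otherwise. Then $d(\mathcal T, \mathcal U; \mathcal B) \le 2$. If moreover all tiles of $\mathcal T$, $\mathcal U$ and $\mathcal B$ are exact, then $d(\mathcal T, \mathcal U; \mathcal B) \le 1$. -/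

import Mathlib

namespace NoisyTiles

/-- A binary dataset with `n` rows (transactions) and `m` columns (attributes). -/
abbrev Dataset (n m : ℕ) : Type := Matrix (Fin n) (Fin m) Bool

/-- A tile: a set of rows together with a set of columns. Tiles without entries are excluded, since
the frequency divides by the number of entries. -/
structure Tile (n m : ℕ) where
  rows : Finset (Fin n)
  cols : Finset (Fin m)
  rows_nonempty : rows.Nonempty
  cols_nonempty : cols.Nonempty

/-- The entries covered by a tile. -/
def Tile.area {n m : ℕ} (T : Tile n m) : Finset (Fin n × Fin m) := T.rows ×ˢ T.cols

/-- The proportion of ones of the dataset `D` in the entries of the tile `T`. -/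
noncomputable def Tile.freq {n m : ℕ} (T : Tile n m) (D : Dataset n m) : ℝ :=
  1 / (T.area.card : ℝ) * ∑ i ∈ T.rows, ∑ j ∈ T.cols, if D i j then 1 else 0

/-- The mean frequency of the tile `T` with respect to a distribution `p` over datasets. -/
noncomputable def Tile.meanFreq {n m : ℕ} (T : Tile n m) (p : Dataset n m → ℝ) : ℝ :=
  ∑ D, p D * T.freq D

/-- A tile set, each of its tiles given together with its target frequency. -/
abbrev TileSet (n m : ℕ) : Type := Set (Tile n m × ℝ)

/-- All tiles of the tile set are exact: their frequencies are `0` or `1`. -/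
def TileSet.IsExact {n m : ℕ} (S : TileSet n m) : Prop := ∀ x ∈ S, x.2 = 0 ∨ x.2 = 1

/-- The probability distributions over datasets that produce the frequencies of `S`. -/
def candidates {n m : ℕ} (S : TileSet n m) : Set (Dataset n m → ℝ) :=
  {p | p ∈ stdSimplex ℝ (Dataset n m) ∧ ∀ x ∈ S, x.1.meanFreq p = x.2}

/-- The frequencies of the tiles in `S` are mutually consistent. -/
def TileSet.Consistent {n m : ℕ} (S : TileSet n m) : Prop := (candidates S).Nonempty

/-- Entropy; `Real.log 0 = 0` gives the convention `0 log 0 = 0`. -/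
noncomputable def entropy {n m : ℕ} (p : Dataset n m → ℝ) : ℝ :=
  -∑ D, p D * Real.log (p D)

open Classical in
/-- Kullback-Leibler divergence, which is infinite when `p` is not absolutely continuous with
respect to `q`. -/
noncomputable def kl {n m : ℕ} (p q : Dataset n m → ℝ) : EReal :=
  if ∃ D, q D = 0 ∧ p D ≠ 0 then ⊤
  else ((∑ D, p D * Real.log (p D / q D) : ℝ) : EReal)

/-- `p` is a maximum entropy distribution for the tile set `S`. -/
def IsMaxEnt {n m : ℕ} (S : TileSet n m) (p : Dataset n m → ℝ) : Prop :=
  p ∈ candidates S ∧ ∀ q ∈ candidates S, entropy q ≤ entropy p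

/-- The maximum entropy distribution of the tile set `S`. For consistent `S` it exists
(`isMaxEnt_maxEnt`) and is unique (`IsMaxEnt.unique`). -/
noncomputable def maxEnt {n m : ℕ} (S : TileSet n m) : Dataset n m → ℝ :=
  Classical.epsilon (IsMaxEnt S)

open Classical in
/-- The distance between the tile sets `T` and `U` given the background tile set `B`. -/
noncomputable def dist {n m : ℕ} (T U B : TileSet n m) : EReal :=
  let M := T ∪ U ∪ B
  if kl (maxEnt M) (maxEnt B) = 0 then 1
  else (kl (maxEnt M) (maxEnt (U ∪ B)) + kl (maxEnt M) (maxEnt (T ∪ B)))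
    / kl (maxEnt M) (maxEnt B)

/-! ### Well-definedness: existence and uniqueness of the model, finiteness of the divergences -/

theorem entropy_eq {n m : ℕ} (p : Dataset n m → ℝ) :
    entropy p = ∑ D, Real.negMulLog (p D) := by
  simp [entropy, Real.negMulLog, Finset.sum_neg_distrib]

theorem exists_isMaxEnt {n m : ℕ} {S : TileSet n m} (hS : S.Consistent) :
    ∃ p, IsMaxEnt S p := by
  have hcl : IsClosed {p : Dataset n m → ℝ | ∀ x ∈ S, x.1.meanFreq p = x.2} := by
    simp only [Set.ofPred_forall]
    refine isClosed_iInter fun x => isClosed_iInter fun _ => isClosed_eq ?_ continuous_const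
    unfold Tile.meanFreq
    fun_prop
  have hK : IsCompact (candidates S) := (isCompact_stdSimplex ℝ (Dataset n m)).inter_right hcl
  have hc : Continuous (entropy : (Dataset n m → ℝ) → ℝ) := by
    have : (entropy : (Dataset n m → ℝ) → ℝ) = fun p => ∑ D, Real.negMulLog (p D) :=
      funext entropy_eq
    rw [this]
    exact continuous_finsetSum _ fun D _ => Real.continuous_negMulLog.comp (continuous_apply D)
  obtain ⟨p, hp, hmax⟩ := hK.exists_isMaxOn hS hc.continuousOn
  exact ⟨p, hp, fun q hq => hmax hq⟩

theorem isMaxEnt_maxEnt {n m : ℕ} {S : TileSet n m} (hS : S.Consistent) :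
    IsMaxEnt S (maxEnt S) :=
  Classical.epsilon_spec (exists_isMaxEnt hS)

theorem candidates_anti {n m : ℕ} {A B : TileSet n m} (h : B ⊆ A) :
    candidates A ⊆ candidates B :=
  fun _ hp => ⟨hp.1, fun x hx => hp.2 x (h hx)⟩

theorem candidates_convex {n m : ℕ} (S : TileSet n m) : Convex ℝ (candidates S) := by
  intro p hp q hq a b ha hb hab
  refine ⟨convex_stdSimplex ℝ _ hp.1 hq.1 ha hb hab, fun x hx => ?_⟩
  have : x.1.meanFreq (a • p + b • q) = a * x.1.meanFreq p + b * x.1.meanFreq q := by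
    simp only [Tile.meanFreq, Finset.mul_sum, ← Finset.sum_add_distrib, Pi.add_apply,
      Pi.smul_apply, smul_eq_mul]
    exact Finset.sum_congr rfl fun D _ => by ring
  rw [this, hp.2 x hx, hq.2 x hx, ← add_mul, hab, one_mul]

theorem IsMaxEnt.unique {n m : ℕ} {S : TileSet n m} {p q : Dataset n m → ℝ}
    (hp : IsMaxEnt S p) (hq : IsMaxEnt S q) : p = q := by
  by_contra hne
  obtain ⟨D₀, hD₀⟩ := Function.ne_iff.mp hne
  have hmem := candidates_convex S hp.1 hq.1 (a := 1 / 2) (b := 1 / 2)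
    (by norm_num) (by norm_num) (by norm_num)
  have h1 := hp.2 _ hmem
  have h2 := hq.2 _ hp.1
  have h3 : (1 / 2 : ℝ) * entropy p + 1 / 2 * entropy q
      < entropy ((1 / 2 : ℝ) • p + (1 / 2 : ℝ) • q) := by
    simp only [entropy_eq, Finset.mul_sum, ← Finset.sum_add_distrib, Pi.add_apply,
      Pi.smul_apply, smul_eq_mul]
    refine Finset.sum_lt_sum (fun D _ => ?_) ⟨D₀, Finset.mem_univ _, ?_⟩
    · exact Real.concaveOn_negMulLog.2 (hp.1.1.1 D) (hq.1.1.1 D)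
        (by norm_num) (by norm_num) (by norm_num)
    · exact Real.strictConcaveOn_negMulLog.2 (hp.1.1.1 D₀) (hq.1.1.1 D₀) hD₀
        (by norm_num) (by norm_num) (by norm_num)
  linarith

theorem IsMaxEnt.support {n m : ℕ} {S : TileSet n m} {p q : Dataset n m → ℝ}
    (hp : IsMaxEnt S p) (hq : q ∈ candidates S) {D₀ : Dataset n m} (h0 : p D₀ = 0) :
    q D₀ = 0 := by
  by_contra hne
  have hq0 : 0 < q D₀ := lt_of_le_of_ne (hq.1.1 D₀) (Ne.symm hne)
  have key : ∀ t : ℝ, 0 < t → t < 1 →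
      entropy q - entropy p + q D₀ * -Real.log t ≤ 0 := by
    intro t ht ht1
    have h1 := hp.2 _ (candidates_convex S hp.1 hq (a := 1 - t) (b := t)
      (by linarith) ht.le (by ring))
    have h2 : (1 - t) * entropy p + t * entropy q + t * (q D₀ * -Real.log t)
        ≤ entropy ((1 - t) • p + t • q) := by
      classical
      have hs : t * (q D₀ * -Real.log t)
          = ∑ D, if D = D₀ then t * (q D₀ * -Real.log t) else 0 := by simp
      rw [hs]
      simp only [entropy_eq, Finset.mul_sum, ← Finset.sum_add_distrib, Pi.add_apply,
        Pi.smul_apply, smul_eq_mul]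
      refine Finset.sum_le_sum fun D _ => ?_
      split_ifs with hD
      · subst hD
        rw [h0, mul_zero, zero_add, Real.negMulLog_mul, Real.negMulLog_zero]
        simp only [Real.negMulLog]
        apply le_of_eq
        ring
      · rw [add_zero]
        exact Real.concaveOn_negMulLog.2 (hp.1.1.1 D) (hq.1.1 D)
          (by linarith) ht.le (by ring)
    have h3 : t * (entropy q - entropy p + q D₀ * -Real.log t) ≤ 0 := by linarith
    exact nonpos_of_mul_nonpos_right h3 ht
  set c : ℝ := (|entropy q - entropy p| + 1) / q D₀ with hc
  have hcpos : 0 < c := by positivity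
  have := key (Real.exp (-c)) (Real.exp_pos _) (by rw [Real.exp_lt_one_iff]; linarith)
  rw [Real.log_exp, neg_neg, hc, mul_div_cancel₀ _ hq0.ne'] at this
  linarith [neg_abs_le (entropy q - entropy p)]

/-- All divergences in the definition of the distance are finite. -/
theorem kl_maxEnt_ne_top {n m : ℕ} {A B : TileSet n m} (hA : A.Consistent) (h : B ⊆ A) :
    kl (maxEnt A) (maxEnt B) ≠ ⊤ := by
  have hB : B.Consistent := hA.mono (candidates_anti h)
  have hno : ¬ ∃ D, maxEnt B D = 0 ∧ maxEnt A D ≠ 0 := by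
    rintro ⟨D, h0, hne⟩
    exact hne ((isMaxEnt_maxEnt hB).support (candidates_anti h (isMaxEnt_maxEnt hA).1) h0)
  rw [kl, if_neg hno]
  exact EReal.coe_ne_top _

end NoisyTiles

namespace NoisyTiles

/-! Write `H(S)` for `entropy (maxEnt S)`. For consistent `M ⊇ S` the divergence of `maxEnt M` from
`maxEnt S` is `H(S) - H(M)` (`kl_maxEnt_eq`), because `log (maxEnt S)` has the same mean under every
candidate of `S`. Both bounds thus become inequalities between entropies. Fewer constraints give
larger `H`, so each term of the numerator is at most the denominator; this gives 2. The bound 1 is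
`H(U ∪ B) + H(T ∪ B) ≤ H(B) + H(M)`. For exact tile sets `H(S)` is the logarithm of the number of
datasets realizing `S` (`entropy_maxEnt_of_isExact`). That number is a product over entries, so the
inequality reduces to one about three subsets of `Bool` (`card_mul_card_le_of_inter_nonempty`). -/

/-! ### Divergences as entropy differences -/

/-- First-order optimality: every candidate has the same cross entropy to the maximum entropy
distribution. -/
theorem IsMaxEnt.sum_mul_log {n m : ℕ} {S : TileSet n m} {p q : Dataset n m → ℝ}
    (hp : IsMaxEnt S p) (hq : q ∈ candidates S) :
    ∑ D, q D * Real.log (p D) = ∑ D, p D * Real.log (p D) := by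
  -- Entropy along the line from `p` through `q`. Since `q` vanishes wherever `p` does, small
  -- negative `t` also stay in the simplex, so the derivative at 0 is zero and not merely
  -- nonpositive.
  set f : ℝ → ℝ := fun t => ∑ D, Real.negMulLog (p D + t * (q D - p D)) with hf
  have hder : HasDerivAt f (∑ D, (-Real.log (p D) - 1) * (q D - p D)) 0 := by
    refine HasDerivAt.fun_sum fun D _ => ?_
    -- `Real.negMulLog` has no derivative at 0, but there the summand is identically zero.
    by_cases h0 : p D = 0
    · have hq0 := hp.support hq h0
      simpa [h0, hq0] using hasDerivAt_const (0 : ℝ) (0 : ℝ)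
    · have hlin : HasDerivAt (fun t : ℝ => p D + t * (q D - p D)) (q D - p D) 0 := by
        simpa using ((hasDerivAt_id (0 : ℝ)).mul_const (q D - p D)).const_add (p D)
      have hlog : HasDerivAt Real.negMulLog (-Real.log (p D) - 1)
          (p D + 0 * (q D - p D)) := by
        simpa using Real.hasDerivAt_negMulLog h0
      exact hlog.comp 0 hlin
  have hnonneg : ∀ᶠ t in nhds (0 : ℝ), ∀ D, 0 ≤ p D + t * (q D - p D) := by
    refine Filter.eventually_all.2 fun D => ?_
    by_cases h0 : p D = 0
    · simp [h0, hp.support hq h0]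
    · have hpos : 0 < p D := lt_of_le_of_ne (hp.1.1.1 D) (Ne.symm h0)
      have hc : ContinuousAt (fun t : ℝ => p D + t * (q D - p D)) 0 := by fun_prop
      have := hc.eventually (lt_mem_nhds (a := 0) (by simpa using hpos))
      exact this.mono fun t ht => ht.le
  have hmax : IsLocalMax f 0 := by
    filter_upwards [hnonneg] with t ht
    have hmem : (fun D => p D + t * (q D - p D)) ∈ candidates S := by
      refine ⟨⟨ht, ?_⟩, fun x hx => ?_⟩
      · rw [Finset.sum_add_distrib, ← Finset.mul_sum, Finset.sum_sub_distrib, hp.1.1.2, hq.1.2]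
        ring
      · have : x.1.meanFreq (fun D => p D + t * (q D - p D))
            = x.1.meanFreq p + t * (x.1.meanFreq q - x.1.meanFreq p) := by
          simp only [Tile.meanFreq, Finset.mul_sum, ← Finset.sum_add_distrib,
            ← Finset.sum_sub_distrib]
          exact Finset.sum_congr rfl fun D _ => by ring
        rw [this, hp.1.2 x hx, hq.2 x hx]
        ring
    have := hp.2 _ hmem
    simpa [hf, entropy_eq] using this
  have hzero := hmax.hasDerivAt_eq_zero hder
  have hsplit : ∑ D, (-Real.log (p D) - 1) * (q D - p D)
      = (∑ D, p D * Real.log (p D) - ∑ D, q D * Real.log (p D)) - (∑ D, q D - ∑ D, p D) := by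
    simp only [← Finset.sum_sub_distrib]
    exact Finset.sum_congr rfl fun D _ => by ring
  rw [hsplit, hp.1.1.2, hq.1.2] at hzero
  linarith

/-- The divergence of a candidate from the maximum entropy distribution is the entropy deficit. -/
theorem IsMaxEnt.kl_eq {n m : ℕ} {S : TileSet n m} {p q : Dataset n m → ℝ}
    (hp : IsMaxEnt S p) (hq : q ∈ candidates S) :
    kl q p = ((entropy p - entropy q : ℝ) : EReal) := by
  have hno : ¬ ∃ D, p D = 0 ∧ q D ≠ 0 := by
    rintro ⟨D, h0, hne⟩
    exact hne (hp.support hq h0)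
  rw [kl, if_neg hno]
  congr 1
  have hterm : ∀ D, q D * Real.log (q D / p D)
      = q D * Real.log (q D) - q D * Real.log (p D) := fun D => by
    by_cases hqD : q D = 0
    · simp [hqD]
    · rw [Real.log_div hqD fun h => hqD (hp.support hq h)]
      ring
  simp only [hterm, Finset.sum_sub_distrib, hp.sum_mul_log hq, entropy]
  ring

theorem TileSet.Consistent.anti {n m : ℕ} {A B : TileSet n m} (hA : A.Consistent) (h : B ⊆ A) :
    B.Consistent :=
  Set.Nonempty.mono (candidates_anti h) hA

theorem kl_maxEnt_eq {n m : ℕ} {A B : TileSet n m} (hA : A.Consistent) (h : B ⊆ A) :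
    kl (maxEnt A) (maxEnt B) = ((entropy (maxEnt B) - entropy (maxEnt A) : ℝ) : EReal) :=
  (isMaxEnt_maxEnt (hA.anti h)).kl_eq (candidates_anti h (isMaxEnt_maxEnt hA).1)

theorem entropy_maxEnt_anti {n m : ℕ} {A B : TileSet n m} (hA : A.Consistent) (h : B ⊆ A) :
    entropy (maxEnt A) ≤ entropy (maxEnt B) :=
  (isMaxEnt_maxEnt (hA.anti h)).2 _ (candidates_anti h (isMaxEnt_maxEnt hA).1)

/-- A bound on the distance amounts to an inequality between entropies. -/
theorem dist_le_of_entropy_le {n m : ℕ} {T U B : TileSet n m}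
    (hM : TileSet.Consistent (T ∪ U ∪ B)) {c : ℝ} (hc : 1 ≤ c)
    (h : (entropy (maxEnt (U ∪ B)) - entropy (maxEnt (T ∪ U ∪ B)))
        + (entropy (maxEnt (T ∪ B)) - entropy (maxEnt (T ∪ U ∪ B)))
      ≤ c * (entropy (maxEnt B) - entropy (maxEnt (T ∪ U ∪ B)))) :
    dist T U B ≤ (c : EReal) := by
  have hB : B ⊆ T ∪ U ∪ B := Set.subset_union_right
  have hUB : U ∪ B ⊆ T ∪ U ∪ B := Set.union_subset_union_left _ Set.subset_union_right
  have hTB : T ∪ B ⊆ T ∪ U ∪ B := Set.union_subset_union_left _ Set.subset_union_left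
  simp only [dist]
  split_ifs with h0
  -- The default value 1 of the distance is what requires `1 ≤ c`.
  · exact_mod_cast hc
  · rw [kl_maxEnt_eq hM hB] at h0 ⊢
    rw [kl_maxEnt_eq hM hUB, kl_maxEnt_eq hM hTB, ← EReal.coe_add, ← EReal.coe_div,
      EReal.coe_le_coe_iff]
    have hpos : 0 < entropy (maxEnt B) - entropy (maxEnt (T ∪ U ∪ B)) :=
      lt_of_le_of_ne (sub_nonneg.2 (entropy_maxEnt_anti hM hB))
        (Ne.symm fun h => h0 (by rw [h, EReal.coe_zero]))
    exact (div_le_iff₀ hpos).2 h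

/-! ### Exact tile sets -/

open Classical in
/-- The values that the entry `(i, j)` may take when the entries of each tile of `S` all equal its
target frequency. -/
noncomputable def allowed {n m : ℕ} (S : TileSet n m) (i : Fin n) (j : Fin m) : Finset Bool :=
  {b | ∀ x ∈ S, i ∈ x.1.rows → j ∈ x.1.cols → (if b then (1 : ℝ) else 0) = x.2}

theorem mem_allowed {n m : ℕ} {S : TileSet n m} {i : Fin n} {j : Fin m} {b : Bool} :
    b ∈ allowed S i j ↔
      ∀ x ∈ S, i ∈ x.1.rows → j ∈ x.1.cols → (if b then (1 : ℝ) else 0) = x.2 := by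
  simp [allowed]

theorem allowed_union {n m : ℕ} (S R : TileSet n m) (i : Fin n) (j : Fin m) :
    allowed (S ∪ R) i j = allowed S i j ∩ allowed R i j := by
  ext b
  simp only [Finset.mem_inter, mem_allowed, Set.mem_union, or_imp, forall_and]

/-- The datasets in which the entries of each tile of `S` all equal its target frequency. -/
noncomputable def realizations {n m : ℕ} (S : TileSet n m) : Finset (Dataset n m) :=
  Fintype.piFinset fun i => Fintype.piFinset fun j => allowed S i j

theorem mem_realizations {n m : ℕ} {S : TileSet n m} {D : Dataset n m} :
    D ∈ realizations S ↔ ∀ i j, D i j ∈ allowed S i j :=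
  Fintype.mem_piFinset.trans (forall_congr' fun _ => Fintype.mem_piFinset)

/-- The requirements on different entries are independent. -/
theorem card_realizations {n m : ℕ} (S : TileSet n m) :
    (realizations S).card = ∏ i, ∏ j, (allowed S i j).card :=
  (Fintype.card_piFinset _).trans (Finset.prod_congr rfl fun _ _ => Fintype.card_piFinset _)

theorem Tile.area_card_pos {n m : ℕ} (T : Tile n m) : (0 : ℝ) < T.area.card :=
  Nat.cast_pos.2 (Finset.card_pos.2 (T.rows_nonempty.product T.cols_nonempty))

theorem Tile.freq_eq_sum_area {n m : ℕ} (T : Tile n m) (D : Dataset n m) :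
    T.freq D = 1 / (T.area.card : ℝ) * ∑ e ∈ T.area, if D e.1 e.2 then 1 else 0 := by
  rw [Tile.freq, Tile.area, Finset.sum_product]

theorem Tile.freq_nonneg {n m : ℕ} (T : Tile n m) (D : Dataset n m) : 0 ≤ T.freq D := by
  rw [T.freq_eq_sum_area]
  exact mul_nonneg (by positivity) (Finset.sum_nonneg fun e _ => by split_ifs <;> norm_num)

/-- As a proportion of zeros, this lets target frequency 1 be treated like target frequency 0. -/
theorem Tile.one_sub_freq {n m : ℕ} (T : Tile n m) (D : Dataset n m) :
    1 - T.freq D = 1 / (T.area.card : ℝ) * ∑ e ∈ T.area, if D e.1 e.2 then 0 else 1 := by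
  have h : ∑ e ∈ T.area, (if D e.1 e.2 then (0 : ℝ) else 1)
      = T.area.card - ∑ e ∈ T.area, if D e.1 e.2 then 1 else 0 := by
    rw [eq_sub_iff_add_eq, ← Finset.sum_add_distrib, Finset.card_eq_sum_ones, Nat.cast_sum]
    exact Finset.sum_congr rfl fun e _ => by split_ifs <;> norm_num
  have := T.area_card_pos.ne'
  rw [h, T.freq_eq_sum_area]
  field_simp

theorem Tile.freq_le_one {n m : ℕ} (T : Tile n m) (D : Dataset n m) : T.freq D ≤ 1 := by
  rw [← sub_nonneg, T.one_sub_freq]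
  exact mul_nonneg (by positivity) (Finset.sum_nonneg fun e _ => by split_ifs <;> norm_num)

theorem Tile.entry_of_freq_eq_zero {n m : ℕ} {T : Tile n m} {D : Dataset n m} (h : T.freq D = 0)
    {i : Fin n} {j : Fin m} (hi : i ∈ T.rows) (hj : j ∈ T.cols) : D i j = false := by
  rw [T.freq_eq_sum_area, mul_eq_zero, or_iff_right (one_div_pos.2 T.area_card_pos).ne',
    Finset.sum_eq_zero_iff_of_nonneg fun e _ => by split_ifs <;> norm_num] at h
  simpa using h (i, j) (Finset.mk_mem_product hi hj)

theorem Tile.entry_of_freq_eq_one {n m : ℕ} {T : Tile n m} {D : Dataset n m} (h : T.freq D = 1)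
    {i : Fin n} {j : Fin m} (hi : i ∈ T.rows) (hj : j ∈ T.cols) : D i j = true := by
  rw [← sub_eq_zero, ← neg_eq_zero, neg_sub, T.one_sub_freq, mul_eq_zero,
    or_iff_right (one_div_pos.2 T.area_card_pos).ne',
    Finset.sum_eq_zero_iff_of_nonneg fun e _ => by split_ifs <;> norm_num] at h
  simpa using h (i, j) (Finset.mk_mem_product hi hj)

theorem freq_of_mem_realizations {n m : ℕ} {S : TileSet n m} {D : Dataset n m}
    (hD : D ∈ realizations S) {x : Tile n m × ℝ} (hx : x ∈ S) : x.1.freq D = x.2 := by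
  have h : ∀ e ∈ x.1.area, (if D e.1 e.2 then (1 : ℝ) else 0) = x.2 := fun e he =>
    mem_allowed.1 (mem_realizations.1 hD e.1 e.2) x hx (Finset.mem_product.1 he).1
      (Finset.mem_product.1 he).2
  have := x.1.area_card_pos.ne'
  rw [x.1.freq_eq_sum_area, Finset.sum_congr rfl h, Finset.sum_const, nsmul_eq_mul]
  field_simp

/-- Candidates of an exact tile set are supported on its realizations. -/
theorem mem_realizations_of_ne_zero {n m : ℕ} {S : TileSet n m} (hS : S.IsExact)
    {p : Dataset n m → ℝ} (hp : p ∈ candidates S) {D : Dataset n m} (hD : p D ≠ 0) :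
    D ∈ realizations S := by
  refine mem_realizations.2 fun i j => mem_allowed.2 fun x hx hi hj => ?_
  have hmean := hp.2 x hx
  -- A nonnegative quantity with mean zero vanishes on the support: the frequency for target 0, its
  -- complement for target 1.
  rcases hS x hx with h | h <;> rw [h] at hmean ⊢
  · rw [Tile.meanFreq, Finset.sum_eq_zero_iff_of_nonneg
      fun D _ => mul_nonneg (hp.1.1 D) (x.1.freq_nonneg D)] at hmean
    have := (mul_eq_zero.1 (hmean D (Finset.mem_univ D))).resolve_left hD
    simp [Tile.entry_of_freq_eq_zero this hi hj]
  · have hsum : ∑ D, p D * (1 - x.1.freq D) = 0 := by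
      simp only [mul_sub, mul_one, Finset.sum_sub_distrib, hp.1.2]
      rw [Tile.meanFreq] at hmean
      rw [hmean, sub_self]
    rw [Finset.sum_eq_zero_iff_of_nonneg
      fun D _ => mul_nonneg (hp.1.1 D) (sub_nonneg.2 (x.1.freq_le_one D))] at hsum
    have := (mul_eq_zero.1 (hsum D (Finset.mem_univ D))).resolve_left hD
    simp [Tile.entry_of_freq_eq_one (sub_eq_zero.1 this).symm hi hj]

theorem TileSet.IsExact.union {n m : ℕ} {S R : TileSet n m} (hS : S.IsExact) (hR : R.IsExact) :
    TileSet.IsExact (S ∪ R) :=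
  fun x hx => hx.elim (hS x) (hR x)

theorem realizations_nonempty {n m : ℕ} {S : TileSet n m} (hS : S.IsExact)
    (hc : S.Consistent) : (realizations S).Nonempty := by
  obtain ⟨p, hp⟩ := hc
  obtain ⟨D, -, hD⟩ := Finset.exists_ne_zero_of_sum_ne_zero (hp.1.2.trans_ne one_ne_zero)
  exact ⟨D, mem_realizations_of_ne_zero hS hp hD⟩

/-! ### Maximal entropy as the logarithm of a count -/

/-- The entropy of a distribution supported on `A` is at most `log |A|`. -/
theorem entropy_le_log_card {n m : ℕ} {p : Dataset n m → ℝ}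
    (hp : p ∈ stdSimplex ℝ (Dataset n m)) {A : Finset (Dataset n m)}
    (hA : ∀ D, p D ≠ 0 → D ∈ A) : entropy p ≤ Real.log A.card := by
  have hsumA : ∑ D ∈ A, p D = 1 := by
    rw [← hp.2]
    exact Finset.sum_subset (Finset.subset_univ A) fun D _ hD => by_contra fun h => hD (hA D h)
  have hcard : (0 : ℝ) < A.card := by
    obtain ⟨D, hD, -⟩ := Finset.exists_ne_zero_of_sum_ne_zero (hsumA.trans_ne one_ne_zero)
    exact Nat.cast_pos.2 (Finset.card_pos.2 ⟨D, hD⟩)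
  -- This is `log x ≤ x - 1` at `x = 1 / (p D * |A|)`, multiplied by `p D`; the corrections sum to
  -- zero over `A`.
  have hterm : ∀ D ∈ A, Real.negMulLog (p D)
      ≤ p D * Real.log A.card + ((A.card : ℝ)⁻¹ - p D) := fun D _ => by
    rcases (hp.1 D).eq_or_lt with h | h
    · rw [← h]
      simp
    · have hlog := Real.log_le_sub_one_of_pos (inv_pos.2 (mul_pos h hcard))
      rw [Real.log_inv, Real.log_mul h.ne' hcard.ne'] at hlog
      have hmul := mul_le_mul_of_nonneg_left hlog h.le
      have hinv : p D * ((p D * A.card)⁻¹ - 1) = (A.card : ℝ)⁻¹ - p D := by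
        have := h.ne'
        field_simp
      rw [hinv] at hmul
      rw [Real.negMulLog]
      linarith
  calc entropy p = ∑ D ∈ A, Real.negMulLog (p D) := by
        rw [entropy_eq]
        refine (Finset.sum_subset (Finset.subset_univ A) fun D _ hD => ?_).symm
        rw [by_contra fun h => hD (hA D h), Real.negMulLog_zero]
    _ ≤ ∑ D ∈ A, (p D * Real.log A.card + ((A.card : ℝ)⁻¹ - p D)) := Finset.sum_le_sum hterm
    _ = Real.log A.card := by
        rw [Finset.sum_add_distrib, ← Finset.sum_mul, Finset.sum_sub_distrib, hsumA,
          Finset.sum_const, nsmul_eq_mul, mul_inv_cancel₀ hcard.ne']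
        ring

/-- The uniform distribution on the realizations shows that the maximal entropy is at least the
logarithm of their number. -/
theorem log_card_realizations_le {n m : ℕ} {S : TileSet n m} (hS : (realizations S).Nonempty) :
    Real.log (realizations S).card ≤ entropy (maxEnt S) := by
  classical
  have hcard : ((realizations S).card : ℝ) ≠ 0 := Nat.cast_ne_zero.2 (Finset.card_pos.2 hS).ne'
  set u : Dataset n m → ℝ :=
    fun D => if D ∈ realizations S then ((realizations S).card : ℝ)⁻¹ else 0 with hu
  have hsum : ∑ D, u D = 1 := by
    rw [hu, Finset.sum_ite_mem, Finset.univ_inter, Finset.sum_const, nsmul_eq_mul,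
      mul_inv_cancel₀ hcard]
  have hmem : u ∈ candidates S := by
    refine ⟨⟨fun D => ?_, hsum⟩, fun x hx => ?_⟩
    · simp only [hu]
      split_ifs <;> positivity
    · have : ∀ D, u D * x.1.freq D = u D * x.2 := fun D => by
        by_cases hD : D ∈ realizations S
        · rw [freq_of_mem_realizations hD hx]
        · simp [hu, hD]
      rw [Tile.meanFreq, Finset.sum_congr rfl fun D _ => this D, ← Finset.sum_mul, hsum, one_mul]
  have hent : entropy u = Real.log (realizations S).card := by
    have : ∀ D, u D * Real.log (u D) = u D * -Real.log (realizations S).card := fun D => by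
      by_cases hD : D ∈ realizations S
      · simp [hu, hD]
      · simp [hu, hD]
    rw [entropy, Finset.sum_congr rfl fun D _ => this D, ← Finset.sum_mul, hsum]
    ring
  rw [← hent]
  exact (isMaxEnt_maxEnt ⟨u, hmem⟩).2 u hmem

theorem entropy_maxEnt_of_isExact {n m : ℕ} {S : TileSet n m} (hS : S.IsExact)
    (hc : S.Consistent) : entropy (maxEnt S) = Real.log (realizations S).card :=
  le_antisymm
    (entropy_le_log_card (isMaxEnt_maxEnt hc).1.1 fun _ hD =>
      mem_realizations_of_ne_zero hS (isMaxEnt_maxEnt hc).1 hD)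
    (log_card_realizations_le (realizations_nonempty hS hc))

/-! ### Submodularity by counting -/

/-- If one factor on the left is 1, the other is at most `Z.card`; otherwise all three sets are
full. Two values are essential: in a three-element `Z`, two pairs meeting in one point give `4 > 3`.
So is a common point: two disjoint singletons in a full `Z` give `1 > 0`. -/
theorem card_mul_card_le_of_inter_nonempty :
    ∀ X Y Z : Finset Bool, (X ∩ Y ∩ Z).Nonempty →
      (Y ∩ Z).card * (X ∩ Z).card ≤ Z.card * (X ∩ Y ∩ Z).card := by
  decide

theorem card_realizations_mul_le {n m : ℕ} {T U B : TileSet n m}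
    (h : (realizations (T ∪ U ∪ B)).Nonempty) :
    (realizations (U ∪ B)).card * (realizations (T ∪ B)).card
      ≤ (realizations B).card * (realizations (T ∪ U ∪ B)).card := by
  obtain ⟨D, hD⟩ := h
  simp only [card_realizations, ← Finset.prod_mul_distrib]
  refine Finset.prod_le_prod' fun i _ => Finset.prod_le_prod' fun j _ => ?_
  -- A common realization supplies the common point at every entry.
  have hij := mem_realizations.1 hD i j
  simp only [allowed_union] at hij ⊢
  exact card_mul_card_le_of_inter_nonempty _ _ _ ⟨_, hij⟩

/-- Submodularity of the maximal entropy on exact tile sets. -/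
theorem entropy_maxEnt_add_le {n m : ℕ} {T U B : TileSet n m}
    (hM : TileSet.Consistent (T ∪ U ∪ B)) (hT : T.IsExact) (hU : U.IsExact) (hB : B.IsExact) :
    entropy (maxEnt (U ∪ B)) + entropy (maxEnt (T ∪ B))
      ≤ entropy (maxEnt B) + entropy (maxEnt (T ∪ U ∪ B)) := by
  have cUB := hM.anti (Set.union_subset_union_left B (Set.subset_union_right (s := T) (t := U)))
  have cTB := hM.anti (Set.union_subset_union_left B (Set.subset_union_left (s := T) (t := U)))
  have cB := hM.anti (Set.subset_union_right (s := T ∪ U) (t := B))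
  have eUB := hU.union hB
  have eTB := hT.union hB
  have eM := (hT.union hU).union hB
  have pos : ∀ {S : TileSet n m}, S.IsExact → S.Consistent → 0 < (realizations S).card :=
    fun hS hc => Finset.card_pos.2 (realizations_nonempty hS hc)
  have ne : ∀ {S : TileSet n m}, S.IsExact → S.Consistent → ((realizations S).card : ℝ) ≠ 0 :=
    fun hS hc => Nat.cast_ne_zero.2 (pos hS hc).ne'
  rw [entropy_maxEnt_of_isExact eUB cUB, entropy_maxEnt_of_isExact eTB cTB,
    entropy_maxEnt_of_isExact hB cB, entropy_maxEnt_of_isExact eM hM,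
    ← Real.log_mul (ne eUB cUB) (ne eTB cTB), ← Real.log_mul (ne hB cB) (ne eM hM)]
  refine Real.log_le_log ?_ ?_
  · exact_mod_cast Nat.mul_pos (pos eUB cUB) (pos eTB cTB)
  · exact_mod_cast card_realizations_mul_le (realizations_nonempty eM hM)

end NoisyTiles

theorem mainTheorem4 {n m : ℕ} (T U B : NoisyTiles.TileSet n m)
    (hcons : NoisyTiles.TileSet.Consistent (T ∪ U ∪ B)) :
    NoisyTiles.dist T U B ≤ 2 ∧
      (NoisyTiles.TileSet.IsExact T → NoisyTiles.TileSet.IsExact U →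
        NoisyTiles.TileSet.IsExact B → NoisyTiles.dist T U B ≤ 1) := by
  refine ⟨?_, fun hT hU hB => ?_⟩
  · have hUB := hcons.anti
      (Set.union_subset_union_left B (Set.subset_union_right (s := T) (t := U)))
    have hTB := hcons.anti
      (Set.union_subset_union_left B (Set.subset_union_left (s := T) (t := U)))
    -- Dropping `U` or `T` down to `B` only raises the entropy, so each divergence in the numerator
    -- is at most the denominator.
    have h1 := NoisyTiles.entropy_maxEnt_anti hUB Set.subset_union_right
    have h2 := NoisyTiles.entropy_maxEnt_anti hTB Set.subset_union_right
    exact_mod_cast NoisyTiles.dist_le_of_entropy_le hcons one_le_two (by linarith)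
  · have h := NoisyTiles.entropy_maxEnt_add_le hcons hT hU hB
    exact_mod_cast NoisyTiles.dist_le_of_entropy_le hcons le_rfl (by linarith)
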